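/- Let $M$ be a closed (that is, compact, Hausdorff, without boundary) smooth manifold of dimension $n\ge 0$, let $T^k=(S^1)^k$ be the $k$-dimensional torus ($k\ge 0$), and let $T^k$ act smoothly on $M$. For $x\in M$ let $\mathrm{ev}\colon T^k\to M$, $\mathrm{ev}(t)=t\cdot x$, be the orbit map at $x$, and suppose that the action is homologically injective, i.e. that for some $x\in M$ the induced homomorphism on singular homology $$\mathrm{ev}_*\colon H_1(T^k;\mathbb Z)=\mathbb Z^k\longrightarrow H_1(M;\mathbb Z)$$ is injective. Let $b_j=\operatorname{rank}H_j(M;\mathbb Z)$ denote the $j$-th Betti number of $M$. Then $$\binom{k}{j}\le b_j\qquad\text{for all } j\ge 0 ,$$ and the inequality of the Halperin--Carlsson conjecture holds: $$2^k\le \sum_{j=0}^{n} b_j .$$ -/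

import Mathlib

open scoped Manifold ContDiff

universe u

noncomputable section

namespace TorusAction

/-- The `k`-dimensional torus `T^k = (S¹)^k`, a group under pointwise multiplication, with the
product topology and the product smooth structure. -/
abbrev Torus (k : ℕ) : Type := Fin k → Circle

/-- The model with corners of the product smooth structure on `Torus k`. -/
abbrev torusModel (k : ℕ) :
    ModelWithCorners ℝ (Fin k → EuclideanSpace ℝ (Fin 1))
      (ModelPi fun _ : Fin k => EuclideanSpace ℝ (Fin 1)) :=
  ModelWithCorners.pi fun _ : Fin k => 𝓡 1

/-- Singular homology with integer coefficients, as a functor on topological spaces in the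
universe `u` (the coefficient group is `ℤ`, lifted to that universe). -/
def integralHomology (j : ℕ) : CategoryTheory.Functor TopCat.{u} (ModuleCat.{u} ℤ) :=
  (AlgebraicTopology.singularHomologyFunctor (ModuleCat.{u} ℤ) j).obj
    (ModuleCat.of ℤ (ULift.{u} ℤ))

/-- The `j`-th Betti number `b_j(X) = rank H_j(X; ℤ)`, the rank being the cardinal number
`Module.rank` (so that no value is assigned by convention in the case of infinite rank). -/
def bettiNumber (X : Type u) [TopologicalSpace X] (j : ℕ) : Cardinal.{u} :=
  Module.rank ℤ ((integralHomology j).obj (TopCat.of X))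

/-- The orbit map `ev : T^k → M`, `ev t = t • x`, at the point `x` (the torus is lifted to the
universe of `M`). -/
def orbitMap (k : ℕ) {M : Type u} [TopologicalSpace M] [MulAction (Torus k) M]
    [ContinuousSMul (Torus k) M] (x : M) : C(ULift.{u} (Torus k), M) where
  toFun t := t.down • x
  continuous_toFun := by fun_prop

/-- The action of `T^k` on `M` is homologically injective (with respect to the base point `x`):
the map `ev_* : H_1(T^k; ℤ) → H_1(M; ℤ)` induced by the orbit map at `x` is injective. -/
def HomologicallyInjectiveAt (k : ℕ) {M : Type u} [TopologicalSpace M] [MulAction (Torus k) M]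
    [ContinuousSMul (Torus k) M] (x : M) : Prop :=
  Function.Injective ((integralHomology.{u} 1).map (TopCat.ofHom (orbitMap k x)))

end TorusAction

end

/-!
Let `f : T^k → M` be injective on `H_1`. As `ℝ` is an injective `ℤ`-module, every real cocycle of
degree one on the torus agrees on cycles with the pullback along `f` of a cocycle on `M`. Hence
there are cocycles `c_1, …, c_k` on `M` whose pullbacks have the same periods as the angular
coordinates of the torus. The cup product of `c_i`, `i ∈ t`, takes on the image of the coordinate
subtorus spanned by `s` the value `det (δ_{ab})_{a ∈ s, b ∈ t}`, which is `1` for `s = t` and `0`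
for every other `j`-element set `s`. So the `Nat.choose k j` coordinate `j`-tori are linearly
independent in `H_j(M; ℤ)`.

Summing over `j` gives `2 ^ k` once `k ≤ dim M`. If `k > dim M`, the derivative of
`v ↦ exp v • x` at `0` kills some `v ≠ 0`, so the one-parameter subgroup `exp (ℝ v)` fixes `x`.
Some nonzero lattice vector `m` lies arbitrarily close to the line `ℝ v`, so the orbit map sends
the loop of direction `m` into a contractible chart neighbourhood of `x`. This loop is then
null-homotopic in `M`, although its class in `H_1(T^k; ℤ)` is not zero.
-/

noncomputable section

open CategoryTheory Limits Opposite Simplicial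

namespace TorusAction

section Cochains

variable {X : SSet.{u}} {G : Type*} [AddCommGroup G] {n : ℕ}

/-- A `G`-valued simplicial cochain is a cocycle if it vanishes on the boundaries of simplices. -/
def IsCocycle (c : X _⦋n⦌ → G) : Prop :=
  ∀ τ : X _⦋n + 1⦌, ∑ i : Fin (n + 2), (-1 : ℤ) ^ i.val • c (X.δ i τ) = 0

lemma IsCocycle.map {G' : Type*} [AddCommGroup G'] {c : X _⦋n⦌ → G} (hc : IsCocycle c)
    (φ : G →+ G') : IsCocycle (φ ∘ c) := fun τ => by
  simpa only [map_sum, map_zsmul, map_zero, Function.comp_apply] using congrArg φ (hc τ)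

lemma isCocycle_one_iff {c : X _⦋1⦌ → G} :
    IsCocycle c ↔ ∀ τ : X _⦋2⦌, c (X.δ 1 τ) = c (X.δ 2 τ) + c (X.δ 0 τ) := by
  refine forall_congr' fun τ => ?_
  rw [Fin.sum_univ_three, ← sub_eq_zero (a := c (X.δ 1 τ)), ← neg_eq_zero]
  simp only [Fin.val_zero, Fin.val_one, Fin.val_two, pow_zero, pow_one, even_two,
    Even.neg_one_pow, one_smul, neg_smul]
  abel_nf

end Cochains

section Pairing

variable {C : Type*} [Category* C] [Preadditive C]

/-- A generalized element of degree `n` of a chain complex that is a cycle. -/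
def IsCycle {K : ChainComplex C ℕ} {T : C} {n : ℕ} (z : T ⟶ K.X n) : Prop :=
  ∀ m, z ≫ K.d n m = 0

/-- The homology class of a cycle. -/
def IsCycle.homologyClass {K : ChainComplex C ℕ} {T : C} {n : ℕ} [K.HasHomology n]
    {z : T ⟶ K.X n} (hz : IsCycle z) : T ⟶ K.homology n :=
  K.liftCycles z _ rfl (hz _) ≫ K.homologyπ n

lemma IsCycle.comp_f {K L : ChainComplex C ℕ} {T : C} {n : ℕ} {z : T ⟶ K.X n} (hz : IsCycle z)
    (f : K ⟶ L) : IsCycle (z ≫ f.f n) := fun m => by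
  rw [Category.assoc, f.comm, reassoc_of% hz m, zero_comp]

variable [HasCoproducts.{u} C] {X Y : SSet.{u}} {R A T : C} {n : ℕ}

/-- The homomorphism on `n`-chains with coefficients in `R` given by a cochain. -/
def cochainHom (c : X _⦋n⦌ → (R ⟶ A)) : (X.chainComplex R).X n ⟶ A :=
  (X.isColimitChainComplexXCofan R n).desc (Cofan.mk A c)

lemma ι_cochainHom (c : X _⦋n⦌ → (R ⟶ A)) (σ : X _⦋n⦌) :
    X.ιChainComplex σ ≫ cochainHom c = c σ :=
  (X.isColimitChainComplexXCofan R n).fac (Cofan.mk A c) ⟨σ⟩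

lemma cochainHom_ι_comp (φ : (X.chainComplex R).X n ⟶ A) :
    cochainHom (fun σ => X.ιChainComplex σ ≫ φ) = φ :=
  SSet.chainComplex_hom_ext fun σ => ι_cochainHom _ σ

lemma chainComplexMap_cochainHom (f : X ⟶ Y) (c : Y _⦋n⦌ → (R ⟶ A)) :
    (SSet.chainComplexMap f R).f n ≫ cochainHom c = cochainHom (c ∘ f.app _) :=
  SSet.chainComplex_hom_ext fun σ => by
    rw [SSet.ι_chainComplexMap_f_assoc, ι_cochainHom, ι_cochainHom, Function.comp_apply]

lemma isCocycle_iff_d_comp_cochainHom {c : X _⦋n⦌ → (R ⟶ A)} :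
    IsCocycle c ↔ (X.chainComplex R).d (n + 1) n ≫ cochainHom c = 0 := by
  have h (τ : X _⦋n + 1⦌) :
      X.ιChainComplex τ ≫ (X.chainComplex R).d (n + 1) n ≫ cochainHom c =
        ∑ i : Fin (n + 2), (-1 : ℤ) ^ i.val • c (X.δ i τ) := by
    simp only [SSet.ιChainComplex_d_assoc, Preadditive.sum_comp, Preadditive.zsmul_comp,
      ι_cochainHom]
  refine ⟨fun hc => SSet.chainComplex_hom_ext fun τ => ?_, fun hc τ => ?_⟩
  · rw [h, hc τ, comp_zero]
  · rw [← h, hc, comp_zero]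

lemma isCycle_ιChainComplex_of_δ_eq {σ : X _⦋1⦌} (hσ : X.δ 0 σ = X.δ 1 σ) :
    IsCycle (K := X.chainComplex R) (X.ιChainComplex σ) := fun m => by
  by_cases hm : (ComplexShape.down ℕ).Rel 1 m
  · obtain rfl : m = 0 := Nat.succ_injective hm
    simp [SSet.ιChainComplex_d, hσ]
  · rw [HomologicalComplex.shape _ _ _ hm, comp_zero]

variable [CategoryWithHomology C]

/-- Evaluation of a cocycle on homology classes. -/
def IsCocycle.homologyEval {c : X _⦋n⦌ → (R ⟶ A)} (hc : IsCocycle c) : X.homology R n ⟶ A :=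
  (X.chainComplex R).homologyι n ≫ (X.chainComplex R).descOpcycles (cochainHom c) (n + 1)
    (ChainComplex.prev ℕ n) (isCocycle_iff_d_comp_cochainHom.mp hc)

lemma IsCycle.homologyClass_homologyEval {z : T ⟶ (X.chainComplex R).X n} (hz : IsCycle z)
    {c : X _⦋n⦌ → (R ⟶ A)} (hc : IsCocycle c) :
    hz.homologyClass ≫ hc.homologyEval = z ≫ cochainHom c := by
  simp only [IsCycle.homologyClass, IsCocycle.homologyEval, Category.assoc,
    HomologicalComplex.homology_π_ι_assoc, HomologicalComplex.liftCycles_i_assoc,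
    HomologicalComplex.p_descOpcycles]

lemma IsCycle.homologyClass_homologyMap {z : T ⟶ (X.chainComplex R).X n} (hz : IsCycle z)
    (f : X ⟶ Y) : hz.homologyClass ≫ SSet.homologyMap f R n =
      (hz.comp_f (SSet.chainComplexMap f R)).homologyClass := by
  simp only [IsCycle.homologyClass, Category.assoc, SSet.homologyMap,
    HomologicalComplex.homologyπ_naturality, HomologicalComplex.liftCycles_comp_cyclesMap_assoc]

lemma IsCycle.homologyClass_homologyMap_homologyEval {z : T ⟶ (X.chainComplex R).X n}
    (hz : IsCycle z) (f : X ⟶ Y) {c : Y _⦋n⦌ → (R ⟶ A)} (hc : IsCocycle c) :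
    hz.homologyClass ≫ SSet.homologyMap f R n ≫ hc.homologyEval =
      z ≫ cochainHom (c ∘ f.app _) := by
  rw [← Category.assoc, hz.homologyClass_homologyMap, homologyClass_homologyEval, Category.assoc,
    chainComplexMap_cochainHom]

lemma exists_isCocycle_homologyEval_eq [Injective A] (ψ : X.homology R n ⟶ A) :
    ∃ (c : X _⦋n⦌ → (R ⟶ A)) (hc : IsCocycle c), hc.homologyEval = ψ := by
  let K := X.chainComplex R
  let h : K.opcycles n ⟶ A := Injective.factorThru ψ (K.homologyι n)
  have hφ : cochainHom (fun σ => X.ιChainComplex σ ≫ K.pOpcycles n ≫ h) = K.pOpcycles n ≫ h :=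
    cochainHom_ι_comp _
  refine ⟨fun σ => X.ιChainComplex σ ≫ K.pOpcycles n ≫ h, ?_, ?_⟩
  · rw [isCocycle_iff_d_comp_cochainHom, hφ, HomologicalComplex.d_pOpcycles_assoc, zero_comp]
  · rw [IsCocycle.homologyEval, ← Injective.comp_factorThru ψ (K.homologyι n)]
    congr 1
    rw [← cancel_epi (K.pOpcycles n), HomologicalComplex.p_descOpcycles, hφ]

lemma IsCocycle.exists_extension (f : X ⟶ Y) [Mono (SSet.homologyMap f R n)] [Injective A]
    {c : X _⦋n⦌ → (R ⟶ A)} (hc : IsCocycle c) :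
    ∃ c' : Y _⦋n⦌ → (R ⟶ A), IsCocycle c' ∧
      ∀ {T : C} {z : T ⟶ (X.chainComplex R).X n}, IsCycle z →
        z ≫ cochainHom (c' ∘ f.app _) = z ≫ cochainHom c := by
  obtain ⟨c', hc', h⟩ := exists_isCocycle_homologyEval_eq
    (Injective.factorThru hc.homologyEval (SSet.homologyMap f R n))
  refine ⟨c', hc', fun hz => ?_⟩
  rw [← hz.homologyClass_homologyMap_homologyEval f hc', h, Injective.comp_factorThru,
    hz.homologyClass_homologyEval]

lemma IsCocycle.comp_cochainHom_eq_of_homologyMap_eq {f g : X ⟶ Y}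
    (hfg : SSet.homologyMap f R n = SSet.homologyMap g R n) {c : Y _⦋n⦌ → (R ⟶ A)}
    (hc : IsCocycle c) {z : T ⟶ (X.chainComplex R).X n} (hz : IsCycle z) :
    z ≫ cochainHom (c ∘ f.app _) = z ≫ cochainHom (c ∘ g.app _) := by
  rw [← hz.homologyClass_homologyMap_homologyEval f hc, hfg,
    hz.homologyClass_homologyMap_homologyEval g hc]

end Pairing

lemma linearIndependent_of_biorthogonal {R S V ι : Type*} [CommRing R] [CommRing S] [Algebra R S]
    [FaithfulSMul R S] [AddCommGroup V] [Module R V] [DecidableEq ι] (v : ι → V)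
    (φ : ι → V →ₗ[R] S) (h : ∀ i j, φ j (v i) = if i = j then 1 else 0) :
    LinearIndependent R v := by
  rw [linearIndependent_iff']
  intro s m hm j hj
  have hj' : ∑ i ∈ s, m i • φ j (v i) = 0 := by
    simpa only [map_sum, map_smul, map_zero] using congrArg (φ j) hm
  simpa [h, Algebra.smul_def, hj] using hj'

section RealCochains

/-- The coefficient module `ℤ` of `integralHomology`. -/
abbrev intCoeff : ModuleCat.{u} ℤ := ModuleCat.of ℤ (ULift.{u} ℤ)

/-- The coefficient module `ℝ`, in the universe of `intCoeff`. -/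
abbrev realCoeff : ModuleCat.{u} ℤ := ModuleCat.of ℤ (ULift.{u} ℝ)

/-- A homomorphism `ℤ → ℝ` corresponds to the image of `1`. -/
def realHomEquiv : (intCoeff.{u} ⟶ realCoeff.{u}) ≃+ ℝ :=
  ModuleCat.homAddEquiv.trans ((ULift.moduleEquiv.arrowCongr ULift.moduleEquiv).trans
    (LinearMap.ringLmapEquivSelf ℤ ℤ ℝ)).toAddEquiv

instance : Injective realCoeff.{u} := by
  have := (Module.Baer.of_divisible (ULift.{u} ℝ)).injective
  exact Module.injective_object_of_injective_module ℤ (ULift.{u} ℝ)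

variable {X Y : SSet.{u}} {n : ℕ}

/-- The value of a real cochain on an integral chain, the latter being given as the image of `1`
under a homomorphism from `ℤ`. -/
def realEval (c : X _⦋n⦌ → ℝ) (z : intCoeff.{u} ⟶ (X.chainComplex intCoeff.{u}).X n) : ℝ :=
  realHomEquiv (z ≫ cochainHom (realHomEquiv.symm ∘ c))

lemma realEval_sum_zsmul_ι (c : X _⦋n⦌ → ℝ) {ι : Type*} (s : Finset ι) (m : ι → ℤ)
    (σ : ι → X _⦋n⦌) :
    realEval c (∑ i ∈ s, m i • X.ιChainComplex (σ i)) = ∑ i ∈ s, m i * c (σ i) := by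
  simp only [realEval, Preadditive.sum_comp, Preadditive.zsmul_comp, ι_cochainHom, map_sum,
    map_zsmul, Function.comp_apply, AddEquiv.apply_symm_apply, zsmul_eq_mul]

lemma realEval_ι (c : X _⦋n⦌ → ℝ) (σ : X _⦋n⦌) : realEval c (X.ιChainComplex σ) = c σ := by
  rw [realEval, ι_cochainHom, Function.comp_apply, AddEquiv.apply_symm_apply]

lemma realEval_comp_chainComplexMap (f : X ⟶ Y) (c : Y _⦋n⦌ → ℝ)
    (z : intCoeff.{u} ⟶ (X.chainComplex intCoeff.{u}).X n) :
    realEval c (z ≫ (SSet.chainComplexMap f intCoeff.{u}).f n) = realEval (c ∘ f.app _) z := by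
  rw [realEval, Category.assoc, chainComplexMap_cochainHom]
  rfl

lemma IsCocycle.exists_real_extension (f : X ⟶ Y) [Mono (SSet.homologyMap f intCoeff.{u} n)]
    {c : X _⦋n⦌ → ℝ} (hc : IsCocycle c) :
    ∃ c' : Y _⦋n⦌ → ℝ, IsCocycle c' ∧
      ∀ {z : intCoeff.{u} ⟶ (X.chainComplex intCoeff.{u}).X n}, IsCycle z →
        realEval (c' ∘ f.app _) z = realEval c z := by
  obtain ⟨c', hc', h⟩ := (hc.map realHomEquiv.{u}.symm.toAddMonoidHom).exists_extension f
  refine ⟨realHomEquiv ∘ c', hc'.map realHomEquiv.toAddMonoidHom, fun hz => ?_⟩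
  rw [realEval, realEval, ← Function.comp_assoc, ← Function.comp_assoc,
    AddEquiv.symm_comp_self, Function.id_comp]
  exact congrArg realHomEquiv (h hz)

lemma IsCocycle.realEval_eq_of_homologyMap_eq {f g : X ⟶ Y}
    (hfg : SSet.homologyMap f intCoeff.{u} n = SSet.homologyMap g intCoeff.{u} n)
    {c : Y _⦋n⦌ → ℝ} (hc : IsCocycle c)
    {z : intCoeff.{u} ⟶ (X.chainComplex intCoeff.{u}).X n} (hz : IsCycle z) :
    realEval (c ∘ f.app _) z = realEval (c ∘ g.app _) z :=
  congrArg realHomEquiv <| IsCocycle.comp_cochainHom_eq_of_homologyMap_eq hfg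
    (hc.map realHomEquiv.{u}.symm.toAddMonoidHom) hz

lemma card_le_rank_homology {ι : Type*} [Fintype ι] [DecidableEq ι]
    {z : ι → (intCoeff.{u} ⟶ (X.chainComplex intCoeff.{u}).X n)} (hz : ∀ i, IsCycle (z i))
    {c : ι → X _⦋n⦌ → ℝ} (hc : ∀ i, IsCocycle (c i))
    (hzc : ∀ i j, realEval (c j) (z i) = if i = j then 1 else 0) :
    (Fintype.card ι : Cardinal.{u}) ≤ Module.rank ℤ (X.homology intCoeff.{u} n :) := by
  let ψ (j : ι) : X.homology intCoeff.{u} n ⟶ realCoeff.{u} :=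
    ((hc j).map realHomEquiv.{u}.symm.toAddMonoidHom).homologyEval
  have hψ (i j : ι) : realHomEquiv ((hz i).homologyClass ≫ ψ j) = if i = j then 1 else 0 := by
    rw [IsCycle.homologyClass_homologyEval]
    exact hzc i j
  have hli : LinearIndependent ℤ fun i => (hz i).homologyClass.hom ⟨1⟩ :=
    linearIndependent_of_biorthogonal (S := ℝ) _
      (fun j => ULift.moduleEquiv.toLinearMap ∘ₗ (ψ j).hom) hψ
  simpa using hli.cardinal_lift_le_rank

end RealCochains

section CupProduct

variable {X : SSet.{u}} {R : Type*} [CommRing R] {n : ℕ}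

/-- The edge of the simplex `σ` joining the vertices `i` and `i + 1`. -/
def spineEdge (σ : X _⦋n⦌) (i : Fin n) : X _⦋1⦌ := X.map (SimplexCategory.mkOfSucc i).op σ

/-- The cup product of `n` cochains of degree one. -/
def cupProduct (a : Fin n → X _⦋1⦌ → R) (σ : X _⦋n⦌) : R := ∏ i, a i (spineEdge σ i)

lemma spineEdge_δ_of_lt (τ : X _⦋n + 1⦌) {l : Fin (n + 2)} {i : Fin n}
    (h : i.succ.castSucc < l) : spineEdge (X.δ l τ) i = spineEdge τ i.castSucc := by
  rw [spineEdge, spineEdge, ← SimplexCategory.mkOfSucc_δ_lt h, op_comp, X.map_comp]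
  rfl

lemma spineEdge_δ_of_gt (τ : X _⦋n + 1⦌) {l : Fin (n + 2)} {i : Fin n}
    (h : l < i.succ.castSucc) : spineEdge (X.δ l τ) i = spineEdge τ i.succ := by
  rw [spineEdge, spineEdge, ← SimplexCategory.mkOfSucc_δ_gt h, op_comp, X.map_comp]
  rfl

lemma exists_triangle_of_spineEdge (τ : X _⦋n + 1⦌) (i : Fin n) :
    ∃ ρ : X _⦋2⦌, X.δ 0 ρ = spineEdge τ i.succ ∧ X.δ 2 ρ = spineEdge τ i.castSucc ∧
      X.δ 1 ρ = spineEdge (X.δ i.succ.castSucc τ) i := by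
  let θ : ⦋2⦌ ⟶ ⦋n + 1⦌ := SimplexCategory.subinterval i.val 2 (by omega)
  have face (l : Fin 3) : X.δ l (X.map θ.op τ) = X.map (SimplexCategory.δ l ≫ θ).op τ := by
    rw [op_comp, X.map_comp]
    rfl
  refine ⟨X.map θ.op τ, ?_, ?_, ?_⟩
  · rw [face, ← SimplexCategory.mkOfSucc_one_eq_δ, SimplexCategory.mkOfSucc_subinterval_eq]
    rfl
  · rw [face, ← SimplexCategory.mkOfSucc_zero_eq_δ, SimplexCategory.mkOfSucc_subinterval_eq]
    rfl
  · have h : SimplexCategory.δ 1 ≫ θ =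
        SimplexCategory.mkOfSucc i ≫ SimplexCategory.δ i.succ.castSucc := by
      rw [SimplexCategory.mkOfSucc_δ_eq rfl, ← SimplexCategory.diag_subinterval_eq]
      congr 1
      decide
    rw [face, h, op_comp, X.map_comp]
    rfl

lemma IsCocycle.apply_spineEdge_δ {c : X _⦋1⦌ → R} (hc : IsCocycle c) (τ : X _⦋n + 1⦌)
    (i : Fin n) : c (spineEdge (X.δ i.succ.castSucc τ) i) =
      c (spineEdge τ i.castSucc) + c (spineEdge τ i.succ) := by
  obtain ⟨ρ, h0, h2, h1⟩ := exists_triangle_of_spineEdge τ i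
  rw [← h0, ← h1, ← h2]
  exact isCocycle_one_iff.mp hc ρ

/-- The product of the values of `a` on the edges of the spine of `τ` other than the `l`-th one. -/
def omitEdgeProd (a : Fin n → X _⦋1⦌ → R) (τ : X _⦋n + 1⦌) (l : Fin (n + 1)) : R :=
  ∏ r, a r (spineEdge τ (l.succAbove r))

lemma cupProduct_δ_zero (a : Fin n → X _⦋1⦌ → R) (τ : X _⦋n + 1⦌) :
    cupProduct a (X.δ 0 τ) = omitEdgeProd a τ 0 :=
  Finset.prod_congr rfl fun r _ => by
    rw [spineEdge_δ_of_gt τ (Fin.succ_pos r), Fin.succAbove_zero]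

lemma cupProduct_δ_last (a : Fin n → X _⦋1⦌ → R) (τ : X _⦋n + 1⦌) :
    cupProduct a (X.δ (Fin.last _) τ) = omitEdgeProd a τ (Fin.last n) :=
  Finset.prod_congr rfl fun r _ => by
    rw [spineEdge_δ_of_lt τ (Fin.castSucc_lt_last _), Fin.succAbove_last]

lemma cupProduct_δ_succ {a : Fin n → X _⦋1⦌ → R} (ha : ∀ i, IsCocycle (a i)) (τ : X _⦋n + 1⦌)
    (r : Fin n) : cupProduct a (X.δ r.succ.castSucc τ) =
      omitEdgeProd a τ r.castSucc + omitEdgeProd a τ r.succ := by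
  rw [add_comm (omitEdgeProd a τ r.castSucc)]
  refine (Finset.prod_add_prod_eq (Finset.mem_univ r) ?_ ?_ ?_).symm
  · rw [Fin.succAbove_succ_self, Fin.succAbove_castSucc_self, (ha r).apply_spineEdge_δ]
  all_goals
    intro s _ hs
    rcases hs.lt_or_gt with h | h
  · rw [spineEdge_δ_of_lt τ (by simpa using h), Fin.succAbove_succ_of_le _ _ h.le]
  · rw [spineEdge_δ_of_gt τ (by simpa using h), Fin.succAbove_succ_of_lt _ _ h]
  · rw [spineEdge_δ_of_lt τ (by simpa using h), Fin.succAbove_castSucc_of_lt _ _ h]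
  · rw [spineEdge_δ_of_gt τ (by simpa using h), Fin.succAbove_castSucc_of_le _ _ h.le]

lemma isCocycle_cupProduct {a : Fin n → X _⦋1⦌ → R} (ha : ∀ i, IsCocycle (a i)) :
    IsCocycle (cupProduct a) := by
  intro τ
  let P (l : Fin (n + 1)) : R := (-1 : ℤ) ^ l.val • omitEdgeProd a τ l
  have hP : P 0 + ∑ r : Fin n, P r.succ = ∑ r : Fin n, P r.castSucc + P (Fin.last n) := by
    rw [← Fin.sum_univ_succ, Fin.sum_univ_castSucc]
  have inner (r : Fin n) : (-1 : ℤ) ^ r.succ.castSucc.val • cupProduct a (X.δ r.succ.castSucc τ) =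
      P r.succ - P r.castSucc := by
    simp only [P, cupProduct_δ_succ ha, Fin.val_castSucc, Fin.val_succ, pow_succ, mul_neg_one,
      neg_smul, smul_add]
    abel
  have outer : (-1 : ℤ) ^ (n + 1) • omitEdgeProd a τ (Fin.last n) = -P (Fin.last n) := by
    simp only [P, Fin.val_last, pow_succ, mul_neg_one, neg_smul]
  rw [Fin.sum_univ_succ, Fin.sum_univ_castSucc]
  simp only [Fin.succ_castSucc, Fin.succ_last, inner, Finset.sum_sub_distrib, cupProduct_δ_zero,
    cupProduct_δ_last, Fin.val_last, outer]
  rw [show (-1 : ℤ) ^ (0 : Fin (n + 2)).val • omitEdgeProd a τ 0 = P 0 from rfl]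
  linear_combination hP

end CupProduct

section Turns

lemma exists_continuous_lift {A : Type*} [TopologicalSpace A] [ContractibleSpace A]
    (s : C(A, Circle)) : ∃ F : C(A, ℝ), ∀ a, Circle.exp (F a) = s a := by
  obtain ⟨z, ⟨H⟩⟩ := (id_nullhomotopic A).comp_right s
  obtain ⟨r, hr⟩ := Circle.exp_surjective z
  have hH (a : A) : H.symm.toContinuousMap (0, a) = Circle.exp (ContinuousMap.const A r a) := by
    simp [hr]
  let G := Circle.isCoveringMap_exp.liftHomotopy H.symm.toContinuousMap _ hH
  refine ⟨G.comp ⟨fun a => (1, a), by fun_prop⟩, fun a => ?_⟩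
  exact (congrFun (Circle.isCoveringMap_exp.liftHomotopy_lifts _ _ hH) (1, a)).trans
    (H.symm.map_one_left a)

variable {A B : Type*} [TopologicalSpace A] [ContractibleSpace A] [TopologicalSpace B]
  [ContractibleSpace B]

/-- The number of turns that a map `s` from a contractible space to the circle makes from `a`
to `b`. -/
def turns (s : C(A, Circle)) (a b : A) : ℝ :=
  ((exists_continuous_lift s).choose b - (exists_continuous_lift s).choose a) / (2 * Real.pi)

lemma turns_eq {s : C(A, Circle)} (F : C(A, ℝ)) (hF : ∀ a, Circle.exp (F a) = s a) (a b : A) :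
    turns s a b = (F b - F a) / (2 * Real.pi) := by
  rw [turns]
  set G := (exists_continuous_lift s).choose
  have hG : ∀ a, Circle.exp (G a) = s a := (exists_continuous_lift s).choose_spec
  have h : (fun x => F x + (G a - F a)) = G := by
    refine Circle.isCoveringMap_exp.eq_of_comp_eq (by fun_prop) (by fun_prop) ?_ a (by simp)
    funext x
    simp [Circle.exp_add, Circle.exp_sub, hF, hG]
  rw [← congrFun h b]
  congr 1
  ring

lemma turns_comp (s : C(A, Circle)) (g : C(B, A)) (a b : B) :
    turns (s.comp g) a b = turns s (g a) (g b) := by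
  obtain ⟨F, hF⟩ := exists_continuous_lift s
  rw [turns_eq F hF, turns_eq (s := s.comp g) (F.comp g) fun x => hF (g x)]
  rfl

lemma turns_add (s : C(A, Circle)) (a b c : A) : turns s a b + turns s b c = turns s a c := by
  obtain ⟨F, hF⟩ := exists_continuous_lift s
  simp only [turns_eq F hF]
  ring

end Turns

section SingularSimplices

variable {X : TopCat.{u}} {n m : ℕ}

instance : ContractibleSpace (stdSimplex ℝ (Fin (n + 1))) :=
  (convex_stdSimplex ℝ (Fin (n + 1))).contractibleSpace
    ⟨_, (stdSimplex.vertex (S := ℝ) (0 : Fin (n + 1))).2⟩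

/-- The singular simplex given by a continuous map on the standard simplex. -/
def singularSimplex (s : C(stdSimplex ℝ (Fin (n + 1)), X)) : (TopCat.toSSet.obj X) _⦋n⦌ :=
  (TopCat.toSSetObjEquiv X (op ⦋n⦌)).symm s

lemma singularSimplex_surjective : Function.Surjective (singularSimplex (X := X) (n := n)) :=
  (TopCat.toSSetObjEquiv X (op ⦋n⦌)).symm.surjective

lemma toSSet_map_singularSimplex (θ : ⦋m⦌ ⟶ ⦋n⦌) (s : C(stdSimplex ℝ (Fin (n + 1)), X)) :
    (TopCat.toSSet.obj X).map θ.op (singularSimplex s) =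
      singularSimplex (s.comp ⟨_, stdSimplex.continuous_map θ.toOrderHom⟩) :=
  rfl

lemma toSSet_map_app_singularSimplex {Y : TopCat.{u}} (f : X ⟶ Y)
    (s : C(stdSimplex ℝ (Fin (n + 1)), X)) :
    (TopCat.toSSet.map f).app _ (singularSimplex s) = singularSimplex (f.hom.comp s) :=
  rfl

lemma δ_singularSimplex (l : Fin (n + 2)) (s : C(stdSimplex ℝ (Fin (n + 2)), X)) :
    (TopCat.toSSet.obj X).δ l (singularSimplex s) =
      singularSimplex (s.comp ⟨_, stdSimplex.continuous_map l.succAbove⟩) :=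
  rfl

/-- The number of turns that a map to the circle makes along an edge. -/
def turnsCochain (f : C(X, Circle)) (σ : (TopCat.toSSet.obj X) _⦋1⦌) : ℝ :=
  turns (f.comp (TopCat.toSSetObjEquiv X (op ⦋1⦌) σ)) (stdSimplex.vertex 0) (stdSimplex.vertex 1)

lemma turnsCochain_singularSimplex (f : C(X, Circle)) (s : C(stdSimplex ℝ (Fin 2), X)) :
    turnsCochain f (singularSimplex s) =
      turns (f.comp s) (stdSimplex.vertex 0) (stdSimplex.vertex 1) :=
  rfl

lemma isCocycle_turnsCochain (f : C(X, Circle)) : IsCocycle (turnsCochain f) := by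
  refine isCocycle_one_iff.mpr fun τ => ?_
  obtain ⟨s, rfl⟩ := singularSimplex_surjective τ
  simp only [δ_singularSimplex, turnsCochain_singularSimplex, ← ContinuousMap.comp_assoc,
    turns_comp, ContinuousMap.coe_mk, stdSimplex.map_vertex]
  exact (turns_add (f.comp s) (stdSimplex.vertex 0) (stdSimplex.vertex 1)
    (stdSimplex.vertex 2)).symm

end SingularSimplices

section AffineSimplices

/-- The universal covering `ℝ^k → T^k` with kernel `ℤ^k`. -/
def torusExp {k : ℕ} (v : Fin k → ℝ) : Torus k := fun i => Circle.exp (2 * Real.pi * v i)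

variable {k n m : ℕ}

lemma torusExp_add (v w : Fin k → ℝ) : torusExp (v + w) = torusExp v * torusExp w := by
  funext i
  simp [torusExp, mul_add, Circle.exp_add]

lemma torusExp_intCast (m : Fin k → ℤ) : torusExp (Int.cast ∘ m) = 1 := by
  funext i
  exact Circle.exp_eq_one.mpr ⟨m i, by simp [mul_comm]⟩

@[fun_prop]
lemma continuous_torusExp : Continuous (torusExp (k := k)) := by
  unfold torusExp
  fun_prop

lemma stdSimplex_sum_map_smul {ι κ V : Type*} [Fintype ι] [Fintype κ] [AddCommGroup V] [Module ℝ V]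
    (f : ι → κ) (t : stdSimplex ℝ ι) (w : κ → V) :
    ∑ p, stdSimplex.map f t p • w p = ∑ q, t q • w (f q) := by
  classical
  rw [← Finset.sum_fiberwise Finset.univ f]
  refine Finset.sum_congr rfl fun p _ => ?_
  rw [stdSimplex.map_coe, FunOnFinite.linearMap_apply_apply, Finset.sum_smul]
  exact Finset.sum_congr rfl fun q hq => by rw [(Finset.mem_filter.mp hq).2]

lemma continuous_stdSimplex_sum_smul {ι V : Type*} [Fintype ι] [AddCommGroup V] [Module ℝ V]
    [TopologicalSpace V] [ContinuousAdd V] [ContinuousSMul ℝ V] (w : ι → V) :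
    Continuous fun t : stdSimplex ℝ ι => ∑ p, t p • w p :=
  continuous_finsetSum _ fun p _ =>
    ((continuous_apply p).comp continuous_subtype_val).smul continuous_const

/-- The torus `T^k`, lifted to the universe `u` as in `orbitMap`. -/
abbrev torusTop (k : ℕ) : TopCat.{u} := TopCat.of (ULift.{u} (Torus k))

/-- The singular simplicial set of the torus. -/
abbrev singularTorus (k : ℕ) : SSet.{u} := TopCat.toSSet.obj (torusTop k)

/-- The image in the torus of the affine simplex in `ℝ^k` with vertices `w`. -/
def affineSimplex (w : Fin (n + 1) → Fin k → ℝ) : (singularTorus.{u} k) _⦋n⦌ :=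
  singularSimplex (X := torusTop k) ⟨fun t => ULift.up (torusExp (∑ p, t p • w p)),
    continuous_uliftUp.comp (continuous_torusExp.comp (continuous_stdSimplex_sum_smul w))⟩

lemma map_affineSimplex (θ : ⦋m⦌ ⟶ ⦋n⦌) (w : Fin (n + 1) → Fin k → ℝ) :
    (singularTorus.{u} k).map θ.op (affineSimplex w) = affineSimplex (w ∘ θ.toOrderHom) := by
  rw [affineSimplex, toSSet_map_singularSimplex, affineSimplex]
  congr 1
  ext1 t
  exact congrArg (ULift.up ∘ torusExp) (stdSimplex_sum_map_smul θ.toOrderHom t w)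

lemma δ_affineSimplex (l : Fin (n + 2)) (w : Fin (n + 2) → Fin k → ℝ) :
    (singularTorus.{u} k).δ l (affineSimplex w) = affineSimplex (w ∘ l.succAbove) :=
  map_affineSimplex (SimplexCategory.δ l) w

lemma affineSimplex_add_intCast (w : Fin (n + 1) → Fin k → ℝ) (m : Fin k → ℤ) :
    affineSimplex.{u} (fun p => w p + Int.cast ∘ m) = affineSimplex w := by
  rw [affineSimplex, affineSimplex]
  congr 1
  ext1 t
  refine congrArg ULift.up ?_
  simp only [smul_add, Finset.sum_add_distrib, ← Finset.sum_smul, stdSimplex.sum_eq_one, one_smul,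
    torusExp_add, torusExp_intCast, mul_one]

/-- The `i`-th coordinate of the torus. -/
def coord (i : Fin k) : C(torusTop.{u} k, Circle) where
  toFun t := t.down i
  continuous_toFun := (continuous_apply i).comp continuous_uliftDown

lemma turnsCochain_coord_affineSimplex (i : Fin k) (w : Fin 2 → Fin k → ℝ) :
    turnsCochain (coord.{u} i) (affineSimplex w) = w 1 i - w 0 i := by
  rw [affineSimplex, turnsCochain_singularSimplex,
    turns_eq ⟨fun t => 2 * Real.pi * (∑ p, t p • w p) i, continuous_const.mul <|
      (continuous_apply i).comp (continuous_stdSimplex_sum_smul w)⟩ fun t => rfl]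
  simp [← mul_sub, Real.pi_ne_zero]

end AffineSimplices

section TorusCycles

lemma partialSum_eq_sum {V : Type*} [AddCommMonoid V] {n : ℕ} (g : Fin n → V) (p : Fin (n + 1)) :
    Fin.partialSum g p = ∑ q with q.castSucc < p, g q := by
  induction p using Fin.induction with
  | zero => simp
  | succ p ih =>
    rw [Fin.partialSum_succ, ih, add_comm, ← Finset.sum_insert (by simp)]
    refine Finset.sum_congr ?_ fun _ _ => rfl
    ext q
    simp [le_iff_eq_or_lt]

lemma partialSum_one {V : Type*} [AddCommMonoid V] (g : Fin 1 → V) :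
    Fin.partialSum g 1 = g 0 := by
  simpa using Fin.partialSum_succ g 0

lemma partialSum_comp_castSucc {V : Type*} [AddCommMonoid V] {n : ℕ} (g : Fin (n + 1) → V)
    (p : Fin (n + 1)) : Fin.partialSum (g ∘ Fin.castSucc) p = Fin.partialSum g p.castSucc := by
  simp only [partialSum_eq_sum, Finset.sum_filter, Fin.sum_univ_castSucc]
  simp [not_lt.mpr (Fin.le_last p)]

lemma partialSum_comp_swap {V : Type*} [AddCommMonoid V] {n : ℕ} (g : Fin (n + 1) → V)
    {r : Fin n} {p : Fin (n + 2)} (hp : p ≠ r.castSucc.succ) :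
    Fin.partialSum (g ∘ Equiv.swap r.castSucc r.succ) p = Fin.partialSum g p := by
  have hswap (q : Fin (n + 1)) :
      (Equiv.swap r.castSucc r.succ q).castSucc < p ↔ q.castSucc < p := by
    rw [Equiv.swap_apply_def]
    simp only [Fin.lt_def, Fin.ext_iff, ne_eq, Fin.val_succ, Fin.val_castSucc] at hp ⊢
    split_ifs <;> simp_all <;> omega
  rw [partialSum_eq_sum, partialSum_eq_sum, Finset.sum_filter, Finset.sum_filter,
    ← Equiv.sum_comp (Equiv.swap r.castSucc r.succ) fun q => if q.castSucc < p then g q else 0]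
  simp only [hswap, Function.comp_apply]

lemma sum_sign_smul_eq_zero_of_swap {ι G : Type*} [Fintype ι] [DecidableEq ι] [AddCommGroup G]
    {f : Equiv.Perm ι → G} {i j : ι} (hij : i ≠ j) (hf : ∀ π, f (π * Equiv.swap i j) = f π) :
    ∑ π : Equiv.Perm ι, (π.sign : ℤ) • f π = 0 := by
  refine Finset.sum_involution (fun π _ => π * Equiv.swap i j) ?_ ?_ ?_ ?_
  · simp [hf, Equiv.Perm.sign_swap hij]
  · exact fun π _ _ h => hij (Equiv.swap_eq_one_iff.mp (mul_eq_left.mp h))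
  · simp
  · simp [mul_assoc]

lemma sum_sign_smul_mul_right {ι G : Type*} [Fintype ι] [DecidableEq ι] [AddCommGroup G]
    (f : Equiv.Perm ι → G) (ρ : Equiv.Perm ι) :
    ∑ π : Equiv.Perm ι, (π.sign : ℤ) • f (π * ρ) =
      (ρ.sign : ℤ) • ∑ π : Equiv.Perm ι, (π.sign : ℤ) • f π := by
  rw [← Equiv.sum_comp (Equiv.mulRight ρ) fun π => (π.sign : ℤ) • f π, Finset.smul_sum]
  refine Finset.sum_congr rfl fun π _ => ?_
  rw [Equiv.coe_mulRight, Equiv.Perm.sign_mul, smul_smul, Units.val_mul, mul_left_comm,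
    Int.units_coe_mul_self, mul_one]

variable {k n : ℕ}

/-- The image in the torus of the simplex spanned by the lattice path with the steps `g`. -/
def pathSimplex (g : Fin n → Fin k → ℤ) : (singularTorus.{u} k) _⦋n⦌ :=
  affineSimplex fun p => Int.cast ∘ Fin.partialSum g p

lemma δ_last_pathSimplex (g : Fin (n + 1) → Fin k → ℤ) :
    (singularTorus.{u} k).δ (Fin.last _) (pathSimplex g) = pathSimplex (g ∘ Fin.castSucc) := by
  rw [pathSimplex, δ_affineSimplex, pathSimplex]
  congr 1
  funext p
  rw [partialSum_comp_castSucc, Function.comp_apply, Fin.succAbove_last]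

lemma δ_zero_pathSimplex (g : Fin (n + 1) → Fin k → ℤ) :
    (singularTorus.{u} k).δ 0 (pathSimplex g) = pathSimplex (g ∘ Fin.succ) := by
  rw [pathSimplex, δ_affineSimplex, pathSimplex,
    ← affineSimplex_add_intCast (fun p => Int.cast ∘ Fin.partialSum (g ∘ Fin.succ) p) (g 0)]
  congr 1
  funext p i
  simp [Fin.partialSum_succ', Fin.tail_def, Function.comp_def, add_comm]

lemma δ_pathSimplex_comp_swap (g : Fin (n + 1) → Fin k → ℤ) (r : Fin n) :
    (singularTorus.{u} k).δ r.castSucc.succ (pathSimplex (g ∘ Equiv.swap r.castSucc r.succ)) =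
      (singularTorus.{u} k).δ r.castSucc.succ (pathSimplex g) := by
  rw [pathSimplex, δ_affineSimplex, pathSimplex, δ_affineSimplex]
  congr 1
  funext p
  rw [Function.comp_apply, partialSum_comp_swap g (Fin.succAbove_ne _ p), Function.comp_apply]

/-- The image of the fundamental cycle of `T^n` under the homomorphism `T^n → T^k` with the columns
`g`: the cube `[0, 1]^n` is triangulated by the lattice paths that take each step once. -/
def torusCycle (g : Fin n → Fin k → ℤ) :
    intCoeff.{u} ⟶ ((singularTorus.{u} k).chainComplex intCoeff.{u}).X n :=
  ∑ π : Equiv.Perm (Fin n), (π.sign : ℤ) • (singularTorus.{u} k).ιChainComplex (pathSimplex (g ∘ π))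

/-- The signed sum of the `l`-th faces of the simplices of `torusCycle g`. -/
def torusCycleFace (g : Fin (n + 1) → Fin k → ℤ) (l : Fin (n + 2)) :
    intCoeff.{u} ⟶ ((singularTorus.{u} k).chainComplex intCoeff.{u}).X n :=
  ∑ π : Equiv.Perm (Fin (n + 1)), (π.sign : ℤ) •
    (singularTorus.{u} k).ιChainComplex ((singularTorus.{u} k).δ l (pathSimplex (g ∘ π)))

lemma torusCycle_comp_d (g : Fin (n + 1) → Fin k → ℤ) :
    torusCycle.{u} g ≫ ((singularTorus.{u} k).chainComplex intCoeff.{u}).d (n + 1) n =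
      ∑ l : Fin (n + 2), (-1 : ℤ) ^ l.val • torusCycleFace g l := by
  simp only [torusCycle, torusCycleFace, Preadditive.sum_comp, Preadditive.zsmul_comp,
    SSet.ιChainComplex_d, Finset.smul_sum]
  rw [Finset.sum_comm]
  exact Finset.sum_congr rfl fun l _ => Finset.sum_congr rfl fun π _ => smul_comm _ _ _

lemma torusCycleFace_castSucc_succ (g : Fin (n + 1) → Fin k → ℤ) (r : Fin n) :
    torusCycleFace.{u} g r.castSucc.succ = 0 :=
  sum_sign_smul_eq_zero_of_swap Fin.castSucc_lt_succ.ne fun π => by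
    rw [Equiv.Perm.coe_mul, ← Function.comp_assoc, δ_pathSimplex_comp_swap]

lemma torusCycleFace_last (g : Fin (n + 1) → Fin k → ℤ) :
    torusCycleFace.{u} g (Fin.last _) = (-1 : ℤ) ^ n • torusCycleFace g 0 := by
  have hrotate (π : Equiv.Perm (Fin (n + 1))) :
      (singularTorus.{u} k).δ 0 (pathSimplex (g ∘ π)) =
        (singularTorus.{u} k).δ (Fin.last _) (pathSimplex (g ∘ (π * finRotate (n + 1)))) := by
    rw [δ_zero_pathSimplex, δ_last_pathSimplex]
    congr 1
    funext q
    simp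
  simp only [torusCycleFace, hrotate]
  rw [sum_sign_smul_mul_right fun π => (singularTorus.{u} k).ιChainComplex
    ((singularTorus.{u} k).δ (Fin.last _) (pathSimplex (g ∘ π))), sign_finRotate, smul_smul]
  simp [← mul_pow]

lemma isCycle_torusCycle (g : Fin n → Fin k → ℤ) : IsCycle (torusCycle.{u} g) := fun m => by
  by_cases hnm : (ComplexShape.down ℕ).Rel n m
  · obtain rfl : m + 1 = n := hnm
    rw [torusCycle_comp_d, Fin.sum_univ_succ, Fin.sum_univ_castSucc]
    simp only [torusCycleFace_castSucc_succ, smul_zero, Finset.sum_const_zero, zero_add,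
      Fin.succ_last, torusCycleFace_last, smul_smul]
    rw [← add_smul]
    simp [pow_succ, ← mul_pow]
  · rw [HomologicalComplex.shape _ _ _ hnm, comp_zero]

/-- The loop in the torus that is the image of the segment from `0` to `m`. -/
def latticeLoop (m : Fin k → ℤ) : (singularTorus.{u} k) _⦋1⦌ := pathSimplex fun _ : Fin 1 => m

lemma isCycle_latticeLoop (m : Fin k → ℤ) :
    IsCycle (K := (singularTorus.{u} k).chainComplex intCoeff.{u})
      ((singularTorus.{u} k).ιChainComplex (latticeLoop m)) :=
  isCycle_ιChainComplex_of_δ_eq <|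
    (δ_zero_pathSimplex _).trans (δ_last_pathSimplex fun _ : Fin 1 => m).symm

lemma turnsCochain_coord_latticeLoop (i : Fin k) (m : Fin k → ℤ) :
    turnsCochain (coord.{u} i) (latticeLoop m) = m i := by
  rw [latticeLoop, pathSimplex, turnsCochain_coord_affineSimplex]
  simp [partialSum_one]

lemma spineEdge_pathSimplex (g : Fin n → Fin k → ℤ) (r : Fin n) :
    spineEdge (pathSimplex.{u} g) r = latticeLoop (g r) := by
  rw [spineEdge, pathSimplex, map_affineSimplex, latticeLoop, pathSimplex,
    ← affineSimplex_add_intCast (fun p => Int.cast ∘ Fin.partialSum (fun _ : Fin 1 => g r) p)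
      (Fin.partialSum g r.castSucc)]
  congr 1
  funext p i
  fin_cases p
  · simp
  · simp [Fin.partialSum_succ, partialSum_one, add_comm]

lemma cupProduct_pathSimplex {R : Type*} [CommRing R] (a : Fin n → (singularTorus.{u} k) _⦋1⦌ → R)
    (g : Fin n → Fin k → ℤ) : cupProduct a (pathSimplex g) = ∏ r, a r (latticeLoop (g r)) := by
  simp only [cupProduct, spineEdge_pathSimplex]

lemma realEval_cupProduct_torusCycle (a : Fin n → (singularTorus.{u} k) _⦋1⦌ → ℝ)
    (g : Fin n → Fin k → ℤ) :
    realEval (cupProduct a) (torusCycle g) =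
      (Matrix.of fun q r => a r (latticeLoop (g q))).det := by
  rw [torusCycle, realEval_sum_zsmul_ι, Matrix.det_apply']
  simp only [cupProduct_pathSimplex, Function.comp_apply, Matrix.of_apply]

end TorusCycles

section BettiNumbers

lemma cupProduct_comp_app {X Y : SSet.{u}} {R : Type*} [CommRing R] {n : ℕ} (f : X ⟶ Y)
    (a : Fin n → Y _⦋1⦌ → R) :
    cupProduct a ∘ f.app _ = cupProduct fun r => a r ∘ f.app _ := by
  funext σ
  simp only [Function.comp_apply, cupProduct]
  refine Finset.prod_congr rfl fun r _ => congrArg (a r) ?_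
  exact (NatTrans.naturality_apply f (SimplexCategory.mkOfSucc r).op σ).symm

lemma det_orderEmbOfFin {α R : Type*} [LinearOrder α] [CommRing R] {n : ℕ} {s t : Finset α}
    (hs : s.card = n) (ht : t.card = n) :
    (Matrix.of fun a b : Fin n =>
      if t.orderEmbOfFin ht b = s.orderEmbOfFin hs a then (1 : R) else 0).det =
      if s = t then 1 else 0 := by
  split_ifs with h
  · subst h
    convert Matrix.det_one (n := Fin n) (R := R) using 2
    ext a b
    simp [Matrix.one_apply, eq_comm]
  · obtain ⟨x, hxt, hxs⟩ : ∃ x ∈ t, x ∉ s := Finset.not_subset.mp fun hts =>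
      h (Finset.eq_of_subset_of_card_le hts (hs.trans ht.symm).le).symm
    obtain ⟨b, rfl⟩ : x ∈ Set.range (t.orderEmbOfFin ht) := by simpa using hxt
    refine Matrix.det_eq_zero_of_column_eq_zero b fun a => ?_
    rw [Matrix.of_apply, if_neg]
    exact fun hab => hxs (hab ▸ s.orderEmbOfFin_mem hs a)

variable {k : ℕ} {M : Type u} [TopologicalSpace M]

lemma mono_homologyMap_of_injective {X Y : TopCat.{u}} {f : X ⟶ Y} {j : ℕ}
    (hf : Function.Injective ((integralHomology.{u} j).map f)) :
    Mono (SSet.homologyMap (TopCat.toSSet.map f) intCoeff.{u} j) :=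
  (ModuleCat.mono_iff_injective ((integralHomology.{u} j).map f)).mpr hf

lemma exists_isCocycle_latticeLoop_eq {f : C(ULift.{u} (Torus k), M)}
    (hf : Function.Injective ((integralHomology.{u} 1).map (TopCat.ofHom f))) (i : Fin k) :
    ∃ c : (TopCat.toSSet.obj (TopCat.of M)) _⦋1⦌ → ℝ, IsCocycle c ∧ ∀ m : Fin k → ℤ,
      c ((TopCat.toSSet.map (TopCat.ofHom f)).app _ (latticeLoop m)) = m i := by
  have := mono_homologyMap_of_injective hf
  obtain ⟨c, hc, h⟩ := (isCocycle_turnsCochain (coord.{u} i)).exists_real_extension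
    (TopCat.toSSet.map (TopCat.ofHom f))
  refine ⟨c, hc, fun m => ?_⟩
  have := h (isCycle_latticeLoop m)
  rwa [realEval_ι, realEval_ι, turnsCochain_coord_latticeLoop] at this

theorem choose_le_bettiNumber {f : C(ULift.{u} (Torus k), M)}
    (hf : Function.Injective ((integralHomology.{u} 1).map (TopCat.ofHom f))) (j : ℕ) :
    (Nat.choose k j : Cardinal.{u}) ≤ bettiNumber M j := by
  choose c hc hcf using exists_isCocycle_latticeLoop_eq hf
  let F := TopCat.toSSet.map (TopCat.ofHom f)
  let S := Finset.powersetCard j (Finset.univ : Finset (Fin k))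
  have hS (s : S) : s.1.card = j := (Finset.mem_powersetCard.mp s.2).2
  let z (s : S) := torusCycle.{u} fun q => Pi.single (s.1.orderEmbOfFin (hS s) q) 1
  let b (t : S) := cupProduct fun r => c (t.1.orderEmbOfFin (hS t) r)
  have hcard : Fintype.card S = Nat.choose k j := by simp [S]
  rw [← hcard]
  refine card_le_rank_homology (fun s => (isCycle_torusCycle _).comp_f
    (SSet.chainComplexMap F intCoeff.{u}) : ∀ s, IsCycle (z s ≫ _))
    (fun t => isCocycle_cupProduct fun r => hc _ : ∀ t, IsCocycle (b t)) fun s t => ?_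
  rw [realEval_comp_chainComplexMap, cupProduct_comp_app, realEval_cupProduct_torusCycle]
  simp only [Function.comp_apply, F, hcf, Pi.single_apply, Int.cast_ite, Int.cast_one,
    Int.cast_zero, det_orderEmbOfFin, Subtype.ext_iff]

end BettiNumbers

section NullhomotopicLoops

variable {k : ℕ}

lemma exists_norm_intCast_sub_smul_lt {v : Fin k → ℝ} (hv : v ≠ 0) {ε : ℝ} (hε : 0 < ε) :
    ∃ (m : Fin k → ℤ) (t : ℝ), m ≠ 0 ∧ ‖Int.cast ∘ m - t • v‖ < ε := by
  obtain ⟨i, hi : v i ≠ 0⟩ := Function.ne_iff.mp hv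
  let w : Fin k → UnitAddCircle := fun j => (v j / v i : ℝ)
  obtain ⟨N, hN, hNw⟩ := Filter.frequently_atTop.mp
    ((mapClusterPt_zero_atTop_nsmul w).frequently (Metric.ball_mem_nhds 0 hε)) 1
  refine ⟨fun j => round (N * (v j / v i)), N / v i, Function.ne_iff.mpr ⟨i, ?_⟩, ?_⟩
  · simpa [hi] using (show N ≠ 0 by omega)
  · rw [dist_zero_right, pi_norm_lt_iff hε] at hNw
    refine (pi_norm_lt_iff hε).mpr fun j => ?_
    have hj := hNw j
    rw [Pi.smul_apply, ← AddCircle.coe_nsmul, UnitAddCircle.norm_eq, nsmul_eq_mul] at hj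
    change |(round (N * (v j / v i)) : ℝ) - N / v i * v j| < ε
    rwa [abs_sub_comm, div_mul_comm, mul_comm (v j / v i)]

/-- The homomorphism `z ↦ (z ^ m i)_i` from the circle to the torus `T^k`. -/
def latticeHom (m : Fin k → ℤ) : C(ULift.{u} (Torus 1), ULift.{u} (Torus k)) where
  toFun z := ULift.up fun i => z.down 0 ^ m i
  continuous_toFun := continuous_uliftUp.comp <| continuous_pi fun i =>
    ((continuous_apply 0).comp continuous_uliftDown).zpow (m i)

lemma latticeHom_torusExp (m : Fin k → ℤ) (v : Fin 1 → ℝ) :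
    latticeHom.{u} m (ULift.up (torusExp v)) = ULift.up (torusExp (v 0 • Int.cast ∘ m)) := by
  refine congrArg ULift.up (funext fun i => ?_)
  change Circle.exp _ ^ m i = Circle.exp _
  rw [← Circle.exp_intCast_mul]
  congr 1
  simp only [Pi.smul_apply, Function.comp_apply, smul_eq_mul]
  ring

lemma latticeHom_latticeLoop (m : Fin k → ℤ) :
    (TopCat.toSSet.map (TopCat.ofHom (latticeHom.{u} m))).app _ (latticeLoop fun _ => 1) =
      latticeLoop m := by
  rw [latticeLoop, pathSimplex, affineSimplex, latticeLoop, pathSimplex, affineSimplex,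
    toSSet_map_app_singularSimplex]
  congr 1
  ext1 t
  refine (latticeHom_torusExp m _).trans (congrArg (ULift.up ∘ torusExp) ?_)
  simp [Fin.sum_univ_two, partialSum_one]

lemma IsCocycle.apply_const {X : TopCat.{u}} {c : (TopCat.toSSet.obj X) _⦋1⦌ → ℝ}
    (hc : IsCocycle c) (y : X) : c (singularSimplex (ContinuousMap.const _ y)) = 0 :=
  left_eq_add.mp (isCocycle_one_iff.mp hc (singularSimplex (ContinuousMap.const _ y)))

variable {M : Type u} [TopologicalSpace M]

lemma eq_zero_of_nullhomotopic_comp_latticeHom {f : C(ULift.{u} (Torus k), M)}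
    (hf : Function.Injective ((integralHomology.{u} 1).map (TopCat.ofHom f))) {m : Fin k → ℤ}
    (hm : (f.comp (latticeHom m)).Nullhomotopic) : m = 0 := by
  funext i
  obtain ⟨y, ⟨H⟩⟩ := hm
  obtain ⟨c, hc, hcf⟩ := exists_isCocycle_latticeLoop_eq hf i
  have hH : TopCat.Homotopy (TopCat.ofHom (f.comp (latticeHom m)))
      (TopCat.ofHom (ContinuousMap.const (ULift.{u} (Torus 1)) y)) := H
  have h := hc.realEval_eq_of_homologyMap_eq
    (hH.congr_homologyMap_singularChainComplexFunctor intCoeff.{u} 1)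
    (isCycle_latticeLoop fun _ : Fin 1 => 1)
  rw [realEval_ι, realEval_ι] at h
  suffices (m i : ℝ) = 0 from mod_cast this
  calc (m i : ℝ) = c ((TopCat.toSSet.map (TopCat.ofHom f)).app _ (latticeLoop m)) := (hcf m).symm
    _ = c ((TopCat.toSSet.map (TopCat.ofHom (f.comp (latticeHom m)))).app _
          (latticeLoop fun _ => 1)) := by rw [← latticeHom_latticeLoop]; rfl
    _ = 0 := h.trans (hc.apply_const y)

end NullhomotopicLoops

section Manifolds

variable {E H : Type*} [NormedAddCommGroup E] [NormedSpace ℝ E] [TopologicalSpace H]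
  {M : Type*} [TopologicalSpace M] [ChartedSpace H M]

lemma exists_mem_nhds_nullhomotopic_subtypeVal (I : ModelWithCorners ℝ E H) (x : M) :
    ∃ U ∈ nhds x, ContinuousMap.Nullhomotopic (⟨Subtype.val, by fun_prop⟩ : C(U, M)) := by
  let φ := extChartAt I x
  obtain ⟨r, hr, hrφ⟩ := Metric.mem_nhdsWithin_iff.mp (extChartAt_target_mem_nhdsWithin (I := I) x)
  let S := Metric.ball (φ x) r ∩ Set.range I
  have : ContractibleSpace S := ((convex_ball _ r).inter I.convex_range).contractibleSpace
    ⟨φ x, Metric.mem_ball_self hr, extChartAt_target_subset_range x (mem_extChartAt_target x)⟩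
  refine ⟨φ.source ∩ φ ⁻¹' Metric.ball (φ x) r, Filter.inter_mem (extChartAt_source_mem_nhds x)
    ((continuousAt_extChartAt x).preimage_mem_nhds (Metric.ball_mem_nhds _ hr)), ?_⟩
  let f : C(↥(φ.source ∩ φ ⁻¹' Metric.ball (φ x) r), S) :=
    ⟨fun y => ⟨φ y, y.2.2, extChartAt_target_subset_range x (φ.map_source y.2.1)⟩,
      ((continuousOn_extChartAt x).comp_continuous continuous_subtype_val
        fun y => y.2.1).subtype_mk _⟩
  let g : C(S, M) := ⟨fun y => φ.symm y,
    (continuousOn_extChartAt_symm x).comp_continuous continuous_subtype_val fun y => hrφ y.2⟩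
  convert ((id_nullhomotopic S).comp_left f).comp_right g using 1
  ext y
  exact (φ.left_inv y.2.1).symm

lemma eq_of_hasMFDerivAt_zero {I : ModelWithCorners ℝ E H} [IsManifold I 1 M] {F : Type*}
    [NormedAddCommGroup F] [NormedSpace ℝ F] {c : F → M}
    (hc : ∀ s, HasMFDerivAt 𝓘(ℝ, F) I c s (0 : F →L[ℝ] E)) (s t : F) : c s = c t := by
  refine IsLocallyConstant.apply_eq_of_preconnectedSpace
    ((IsLocallyConstant.iff_eventually_eq c).mpr fun s => ?_) s t
  have hU : c ⁻¹' (chartAt H (c s)).source ∈ nhds s :=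
    (hc s).continuousAt.preimage_mem_nhds (chart_source_mem_nhds H _)
  obtain ⟨ε, hε, hball⟩ := Metric.mem_nhds_iff.mp hU
  have hψ (r : F) (hr : r ∈ Metric.ball s ε) :
      HasFDerivAt (extChartAt I (c s) ∘ c) (0 : F →L[ℝ] E) r := by
    let L : E →L[ℝ] E := mfderiv I 𝓘(ℝ, E) (extChartAt I (c s)) (c r)
    rw [← (L.comp_zero : L.comp (0 : F →L[ℝ] E) = 0)]
    exact ((mdifferentiableAt_extChartAt (I := I) (hball hr)).hasMFDerivAt.comp r
      (hc r)).hasFDerivAt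
  filter_upwards [Metric.ball_mem_nhds s hε] with r hr
  have heq : (extChartAt I (c s) ∘ c) r = (extChartAt I (c s) ∘ c) s :=
    Metric.isOpen_ball.is_const_of_fderiv_eq_zero (convex_ball s ε).isPreconnected
      (fun p hp => (hψ p hp).differentiableAt.differentiableWithinAt)
      (fun p hp => (hψ p hp).fderiv) hr (Metric.mem_ball_self hε)
  have hinj := (extChartAt I (c s)).injOn
  rw [extChartAt_source] at hinj
  exact hinj (hball hr) (hball (Metric.mem_ball_self hε)) heq

lemma contMDiff_pi {𝕜 : Type*} [NontriviallyNormedField 𝕜] {E : Type*} [NormedAddCommGroup E]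
    [NormedSpace 𝕜 E] {H : Type*} [TopologicalSpace H] {I : ModelWithCorners 𝕜 E H} {N : Type*}
    [TopologicalSpace N] [ChartedSpace H N] {ι : Type*} [Fintype ι] {E' : ι → Type*}
    [∀ i, NormedAddCommGroup (E' i)] [∀ i, NormedSpace 𝕜 (E' i)] {H' : ι → Type*}
    [∀ i, TopologicalSpace (H' i)] {J : ∀ i, ModelWithCorners 𝕜 (E' i) (H' i)} {P : ι → Type*}
    [∀ i, TopologicalSpace (P i)] [∀ i, ChartedSpace (H' i) (P i)] {r : ℕ∞ω} {f : N → ∀ i, P i}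
    (hf : ∀ i, ContMDiff I (J i) r fun x => f x i) :
    ContMDiff I (ModelWithCorners.pi J) r f := fun x =>
  contMDiffAt_iff.mpr ⟨continuousAt_pi.mpr fun i => (hf i).continuous.continuousAt,
    contDiffWithinAt_pi.mpr fun i => (contMDiffAt_iff.mp (hf i x)).2⟩

end Manifolds

section Dimension

variable {k : ℕ}

lemma contMDiff_torusExp : ContMDiff 𝓘(ℝ, Fin k → ℝ) (torusModel k) ∞ (torusExp (k := k)) :=
  contMDiff_pi fun i => contMDiff_circleExp.comp <| contMDiff_const.mul
    (ContinuousLinearMap.proj (R := ℝ) (φ := fun _ : Fin k => ℝ) i).contMDiff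

lemma torusExp_zero : torusExp (0 : Fin k → ℝ) = 1 := by
  funext i
  simp [torusExp]

lemma exists_torusExp_eq (z : Torus 1) : ∃ v : Fin 1 → ℝ, |v 0| ≤ 1 ∧ torusExp v = z := by
  refine ⟨fun i => (z i : ℂ).arg / (2 * Real.pi), ?_, funext fun i => ?_⟩
  · rw [abs_div, abs_of_pos Real.two_pi_pos, div_le_one Real.two_pi_pos]
    linarith [Complex.abs_arg_le_pi (z 0 : ℂ), Real.pi_pos]
  · rw [torusExp, mul_div_cancel₀ _ Real.two_pi_pos.ne', Circle.exp_arg]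

variable {E H : Type*} [NormedAddCommGroup E] [NormedSpace ℝ E] [TopologicalSpace H]
  {I : ModelWithCorners ℝ E H} {M : Type*} [TopologicalSpace M] [ChartedSpace H M]
  [MulAction (Torus k) M] [ContMDiffSMul (torusModel k) I 1 (Torus k) M]

lemma hasMFDerivAt_torusExp_smul {x : M} {D : (Fin k → ℝ) →L[ℝ] E}
    (hD : HasMFDerivAt 𝓘(ℝ, Fin k → ℝ) I (fun w : Fin k → ℝ => torusExp w • x) 0 D) {v : Fin k → ℝ}
    (hv : D v = 0) (s : ℝ) :
    HasMFDerivAt 𝓘(ℝ, ℝ) I (fun r : ℝ => torusExp (r • v) • x) s (0 : ℝ →L[ℝ] E) := by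
  let ev (w : Fin k → ℝ) : M := torusExp w • x
  let g (y : M) : M := torusExp (s • v) • y
  have hline : HasMFDerivAt 𝓘(ℝ, ℝ) 𝓘(ℝ, Fin k → ℝ) (fun r : ℝ => (r - s) • v) s
      (ContinuousLinearMap.toSpanSingleton ℝ v) := by
    have := (((hasDerivAt_id s).sub_const s).smul_const v).hasFDerivAt
    rw [one_smul] at this
    exact this.hasMFDerivAt
  have hev : HasMFDerivAt 𝓘(ℝ, Fin k → ℝ) I ev ((s - s) • v) D := by
    rwa [sub_self, zero_smul]
  have hg : MDifferentiable I I g :=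
    (ContMDiffSMul.contMDiff_const_smul (I := torusModel k) (torusExp (s • v))).mdifferentiable
      one_ne_zero
  have hcurve : (g ∘ ev ∘ fun r : ℝ => (r - s) • v) = fun r => torusExp (r • v) • x := by
    funext r
    simp only [g, ev, Function.comp_apply, smul_smul, ← torusExp_add, ← add_smul,
      add_sub_cancel]
  have hzero : D.comp (ContinuousLinearMap.toSpanSingleton ℝ v) = 0 := by
    ext1
    simpa using hv
  let L : E →L[ℝ] E := mfderiv I I g (ev ((s - s) • v))
  rw [← hcurve, ← (L.comp_zero : L.comp (0 : ℝ →L[ℝ] E) = 0), ← hzero]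
  exact (hg _).hasMFDerivAt.comp s (hev.comp s hline)

lemma exists_torusExp_smul_eq [FiniteDimensional ℝ E] [IsManifold I 1 M]
    (hk : Module.finrank ℝ E < k) (x : M) :
    ∃ v : Fin k → ℝ, v ≠ 0 ∧ ∀ s : ℝ, torusExp (s • v) • x = x := by
  have hev : MDifferentiable 𝓘(ℝ, Fin k → ℝ) I fun v : Fin k → ℝ => torusExp v • x :=
    ((contMDiff_torusExp.of_le (by simp)).smul (I := torusModel k) contMDiff_const).mdifferentiable
      one_ne_zero
  let D : (Fin k → ℝ) →L[ℝ] E :=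
    mfderiv 𝓘(ℝ, Fin k → ℝ) I (fun v : Fin k → ℝ => torusExp v • x) 0
  obtain ⟨v, hv, hv0⟩ := Submodule.exists_mem_ne_zero_of_ne_bot
    (LinearMap.ker_ne_bot_of_finrank_lt (f := D.toLinearMap) (by simpa using hk))
  refine ⟨v, hv0, fun s => ?_⟩
  rw [eq_of_hasMFDerivAt_zero (hasMFDerivAt_torusExp_smul (hev 0).hasMFDerivAt hv) s 0, zero_smul,
    torusExp_zero, one_smul]

end Dimension

section RankBound

variable {k : ℕ} {E H : Type*} [NormedAddCommGroup E] [NormedSpace ℝ E] [FiniteDimensional ℝ E]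
  [TopologicalSpace H] {M : Type u} [TopologicalSpace M] [ChartedSpace H M] [MulAction (Torus k) M]
  [ContinuousSMul (Torus k) M]

lemma HomologicallyInjectiveAt.le_finrank (I : ModelWithCorners ℝ E H) [IsManifold I 1 M]
    [ContMDiffSMul (torusModel k) I 1 (Torus k) M] {x : M} (hx : HomologicallyInjectiveAt k x) :
    k ≤ Module.finrank ℝ E := by
  by_contra! hk
  obtain ⟨v, hv, hvx⟩ := exists_torusExp_smul_eq (I := I) hk x
  obtain ⟨U, hU, hUM⟩ := exists_mem_nhds_nullhomotopic_subtypeVal I x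
  have hexp : Continuous fun w : Fin k → ℝ => torusExp w • x := by fun_prop
  obtain ⟨δ, hδ, hδU⟩ := Metric.mem_nhds_iff.mp <|
    hexp.continuousAt.preimage_mem_nhds (x := 0) (by rwa [torusExp_zero, one_smul])
  obtain ⟨m, t, hm, hmt⟩ := exists_norm_intCast_sub_smul_lt hv hδ
  have hloop (z : ULift.{u} (Torus 1)) : orbitMap k x (latticeHom m z) ∈ U := by
    obtain ⟨θ, hθ, hz : torusExp θ = z.down⟩ := exists_torusExp_eq z.down
    have hθδ : θ 0 • (Int.cast ∘ m - t • v) ∈ Metric.ball 0 δ := by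
      rw [mem_ball_zero_iff, norm_smul]
      exact (mul_le_of_le_one_left (norm_nonneg _) hθ).trans_lt hmt
    have horbit : orbitMap k x (latticeHom m z) =
        torusExp (θ 0 • (Int.cast ∘ m - t • v)) • x := by
      calc orbitMap k x (latticeHom m z) = torusExp (θ 0 • Int.cast ∘ m) • x := by
            rw [← ULift.up_down z, ← hz, latticeHom_torusExp]
            rfl
        _ = torusExp (θ 0 • (Int.cast ∘ m - t • v)) • torusExp ((θ 0 * t) • v) • x := by
            rw [smul_smul, ← torusExp_add, smul_sub, smul_smul, sub_add_cancel]
        _ = torusExp (θ 0 • (Int.cast ∘ m - t • v)) • x := by rw [hvx]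
    rw [horbit]
    exact hδU hθδ
  let g : C(ULift.{u} (Torus 1), U) :=
    ⟨fun z => ⟨_, hloop z⟩, ((orbitMap k x).comp (latticeHom m)).continuous.subtype_mk _⟩
  exact hm (eq_zero_of_nullhomotopic_comp_latticeHom hx (hUM.comp_left g))

end RankBound

end TorusAction

end

theorem corollary2p3_general {k : ℕ} {E H : Type*} [NormedAddCommGroup E] [NormedSpace ℝ E]
    [FiniteDimensional ℝ E] [TopologicalSpace H] (I : ModelWithCorners ℝ E H) {M : Type u}
    [TopologicalSpace M] [ChartedSpace H M] [IsManifold I 1 M] [MulAction (TorusAction.Torus k) M]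
    [ContinuousSMul (TorusAction.Torus k) M]
    [ContMDiffSMul (TorusAction.torusModel k) I 1 (TorusAction.Torus k) M]
    (x : M) (hx : TorusAction.HomologicallyInjectiveAt k x) :
    (∀ j : ℕ, (Nat.choose k j : Cardinal.{u}) ≤ TorusAction.bettiNumber M j) ∧
      ((2 ^ k : ℕ) : Cardinal.{u}) ≤
        ∑ j ∈ Finset.range (Module.finrank ℝ E + 1), TorusAction.bettiNumber M j := by
  have hchoose := TorusAction.choose_le_bettiNumber hx
  have hk : k ≤ Module.finrank ℝ E := hx.le_finrank I
  refine ⟨hchoose, ?_⟩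
  calc ((2 ^ k : ℕ) : Cardinal.{u})
      = ∑ j ∈ Finset.range (k + 1), (Nat.choose k j : Cardinal.{u}) := by
        rw [← Nat.sum_range_choose, Nat.cast_sum]
    _ ≤ ∑ j ∈ Finset.range (k + 1), TorusAction.bettiNumber M j :=
        Finset.sum_le_sum fun j _ => hchoose j
    _ ≤ _ := Finset.sum_le_sum_of_subset (Finset.range_mono (by omega))

theorem corollary2p3 {k n : ℕ} {M : Type u} [TopologicalSpace M] [T2Space M] [CompactSpace M]
    [ChartedSpace (EuclideanSpace ℝ (Fin n)) M] [IsManifold (𝓡 n) ∞ M]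
    [MulAction (TorusAction.Torus k) M] [ContinuousSMul (TorusAction.Torus k) M]
    [ContMDiffSMul (TorusAction.torusModel k) (𝓡 n) ∞ (TorusAction.Torus k) M]
    (x : M) (hx : TorusAction.HomologicallyInjectiveAt k x) :
    (∀ j : ℕ, (Nat.choose k j : Cardinal.{u}) ≤ TorusAction.bettiNumber M j) ∧
      ((2 ^ k : ℕ) : Cardinal.{u}) ≤ ∑ j ∈ Finset.range (n + 1), TorusAction.bettiNumber M j := by
  simpa using corollary2p3_general (𝓡 n) x hx
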